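/- Let $d$ be a natural number and, for $s>0$ and $x\in\mathbb R^d$, let $$g_d(s,x)=\frac1{(2\pi s)^{d/2}}\exp\{-|x|^2/(2s)\}.$$ Let $(T_t)_{t\ge0}$ be the transition semigroup of standard Brownian motion on the real Hilbert space $L^2(\mathbb R^d)$, that is, $T_0=I$ and $T_tf=\int_{\mathbb R^d}g_d(t,\cdot-z)f(z)\,dz$ for $t>0$. Let $\tilde L^2(\mathbb R^d)$ be its entrance space: the set of all paths $\tilde x:(0,\infty)\to L^2(\mathbb R^d)$ such that $\tilde x(r+t)=T_t\tilde x(r)$ for all $r,t>0$ and $\int_0^l\|\tilde x(s)\|^2\,ds<\infty$ for some $l>0$. Let $\tilde L^2_+(\mathbb R^d)$ be the set of those $\tilde x\in\tilde L^2(\mathbb R^d)$ such that $\tilde x(s)\ge0$ almost everywhere for every $s>0$. Let $S_+(\mathbb R^d)$ be the set of all non-negative (finite or infinite) Borel measures $\mu$ on $\mathbb R^d$ such that, for some $l>0$, $$\int_0^l ds\int_{\mathbb R^d}\mu(dx)\int_{\mathbb R^d}g_d(2s,y-x)\,\mu(dy)<\infty .$$ **Theorem.** There is a one-to-one correspondence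 (a bijection) between $\tilde x\in\tilde L^2_+(\mathbb R^d)$ and $\mu\in S_+(\mathbb R^d)$ such that $\tilde x$ and $\mu$ correspond to each other if and only if $$\tilde x(s,\cdot)=\int_{\mathbb R^d}g_d(s,\cdot-z)\,\mu(dz)\quad\text{for every } s>0,$$ where the equality is one of elements of $L^2(\mathbb R^d)$, that is, for almost every $y\in\mathbb R^d$ the function $g_d(s,y-\cdot)$ is $\mu$-integrable and $\tilde x(s,y)$ equals its integral. -/

import Mathlib

open MeasureTheory
open scoped ENNReal

namespace BrownianEntrance

/-- The type of positive times `s > 0`. -/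
abbrev PosTime : Type := {s : ℝ // 0 < s}

section EntranceSpace

variable {H : Type*} [NormedAddCommGroup H] [NormedSpace ℝ H]

/-- The entrance paths of a one-parameter semigroup `(T_t)_{t ≥ 0}` of bounded operators on `H`:
paths `x : (0, ∞) → H` with `x (r + t) = T_t (x r)` for all `r, t > 0`. (Only the values `T t` with
`t ≥ 0` are meaningful.) -/
def entrancePaths (T : ℝ → H →L[ℝ] H) : Set (PosTime → H) :=
  {x | ∀ r t : PosTime, x (r + t) = T t (x r)}

/-- A path `x : (0, ∞) → H` is locally square integrable if `∫_0^l ‖x s‖² ds < ∞`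
for some `l > 0`. -/
def LocallySquareIntegrable (x : PosTime → H) : Prop :=
  ∃ l : ℝ, 0 < l ∧
    ∫⁻ s in {s : PosTime | (s : ℝ) ≤ l}, ‖x s‖ₑ ^ 2 ∂(volume : Measure ℝ).comap Subtype.val < ∞

/-- The entrance space of `(T_t)_{t ≥ 0}`: its locally square integrable entrance paths. -/
def entranceSpace (T : ℝ → H →L[ℝ] H) : Set (PosTime → H) :=
  {x | x ∈ entrancePaths T ∧ LocallySquareIntegrable x}

end EntranceSpace

/-- The heat kernel `g_d(s, x) = (2 π s)^(-d/2) exp (-|x|² / (2 s))` on `ℝ^d`, for `s > 0`. -/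
noncomputable def heatKernel (d : ℕ) (s : ℝ) (x : EuclideanSpace ℝ (Fin d)) : ℝ :=
  1 / (2 * Real.pi * s) ^ ((d : ℝ) / 2) * Real.exp (-‖x‖ ^ 2 / (2 * s))

/-- The real Hilbert space `L²(ℝ^d)` with respect to Lebesgue measure. -/
abbrev L2 (d : ℕ) : Type := Lp ℝ 2 (volume : Measure (EuclideanSpace ℝ (Fin d)))

section Semigroup

variable {d : ℕ} {t : ℝ}

lemma continuous_heatKernel (d : ℕ) (t : ℝ) : Continuous (heatKernel d t) := by
  unfold heatKernel
  fun_prop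

lemma heatKernel_nonneg (ht : 0 < t) (x : EuclideanSpace ℝ (Fin d)) : 0 ≤ heatKernel d t x := by
  unfold heatKernel
  positivity

lemma integral_heatKernel (ht : 0 < t) : ∫ x, heatKernel d t x = 1 := by
  have hb : 0 < (2 * t)⁻¹ := by positivity
  have h := GaussianFourier.integral_rexp_neg_mul_sq_norm (V := EuclideanSpace ℝ (Fin d)) hb
  have h2 : Real.pi / (2 * t)⁻¹ = 2 * Real.pi * t := by field_simp
  rw [h2, finrank_euclideanSpace_fin] at h
  have h3 : ∀ x : EuclideanSpace ℝ (Fin d), heatKernel d t x =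
      1 / (2 * Real.pi * t) ^ ((d : ℝ) / 2) * Real.exp (-(2 * t)⁻¹ * ‖x‖ ^ 2) := by
    intro x
    unfold heatKernel
    congr 2
    field_simp
  simp_rw [h3]
  rw [integral_const_mul, h]
  have : (0 : ℝ) < (2 * Real.pi * t) ^ ((d : ℝ) / 2) := by positivity
  field_simp

lemma integrable_heatKernel (ht : 0 < t) : Integrable (heatKernel d t) := by
  by_contra h
  have := integral_heatKernel (d := d) ht
  rw [integral_undef h] at this
  exact zero_ne_one this

lemma lintegral_heatKernel (ht : 0 < t) : ∫⁻ x, ‖heatKernel d t x‖ₑ = 1 := by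
  rw [← ofReal_integral_norm_eq_lintegral_enorm (integrable_heatKernel ht)]
  simp_rw [Real.norm_of_nonneg (heatKernel_nonneg ht _)]
  rw [integral_heatKernel ht, ENNReal.ofReal_one]

lemma lintegral_heatKernel_sub_left (ht : 0 < t) (y : EuclideanSpace ℝ (Fin d)) :
    ∫⁻ z, ‖heatKernel d t (y - z)‖ₑ = 1 := by
  rw [lintegral_sub_left_eq_self (fun z => ‖heatKernel d t z‖ₑ) y, lintegral_heatKernel ht]

lemma lintegral_heatKernel_sub_right (ht : 0 < t) (z : EuclideanSpace ℝ (Fin d)) :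
    ∫⁻ y, ‖heatKernel d t (y - z)‖ₑ = 1 := by
  rw [lintegral_sub_right_eq_self (fun z => ‖heatKernel d t z‖ₑ) z, lintegral_heatKernel ht]

/-- Action of the Brownian transition kernel on functions: `y ↦ ∫ g_d(t, y - z) f(z) dz`. -/
noncomputable def heatConv (d : ℕ) (t : ℝ) (f : EuclideanSpace ℝ (Fin d) → ℝ)
    (y : EuclideanSpace ℝ (Fin d)) : ℝ :=
  ∫ z, heatKernel d t (y - z) * f z

lemma integrable_heatKernel_mul (ht : 0 < t) {f : EuclideanSpace ℝ (Fin d) → ℝ}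
    (hf : MemLp f 2 volume) (y : EuclideanSpace ℝ (Fin d)) :
    Integrable (fun z => heatKernel d t (y - z) * f z) := by
  have hg : MemLp (fun z => heatKernel d t (y - z)) 2 volume := by
    have hc : Continuous (fun z => heatKernel d t (y - z)) :=
      (continuous_heatKernel d t).comp (by fun_prop)
    have hi : Integrable (fun z => heatKernel d t (y - z)) :=
      (integrable_heatKernel ht).comp_sub_left y
    rw [memLp_two_iff_integrable_sq hc.aestronglyMeasurable]
    refine (hi.const_mul (1 / (2 * Real.pi * t) ^ ((d : ℝ) / 2))).mono'
      (hc.pow 2).aestronglyMeasurable (Filter.Eventually.of_forall fun z => ?_)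
    have h0 := heatKernel_nonneg ht (y - z)
    have h1 : heatKernel d t (y - z) ≤ 1 / (2 * Real.pi * t) ^ ((d : ℝ) / 2) := by
      unfold heatKernel
      refine mul_le_of_le_one_right (by positivity) (Real.exp_le_one_iff.2 ?_)
      rw [neg_div]
      have : 0 ≤ ‖y - z‖ ^ 2 / (2 * t) := by positivity
      linarith
    rw [Real.norm_of_nonneg (by positivity), sq]
    exact mul_le_mul_of_nonneg_right h1 h0
  exact hg.integrable_mul hf

lemma enorm_heatConv_sq_le (ht : 0 < t) {f : EuclideanSpace ℝ (Fin d) → ℝ}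
    (hf : AEStronglyMeasurable f volume) (y : EuclideanSpace ℝ (Fin d)) :
    ‖heatConv d t f y‖ₑ ^ 2 ≤ ∫⁻ z, ‖heatKernel d t (y - z)‖ₑ * ‖f z‖ₑ ^ 2 := by
  have hm : Measurable fun z => ‖heatKernel d t (y - z)‖ₑ :=
    ((continuous_heatKernel d t).comp (by fun_prop)).measurable.enorm
  have h1 : ‖heatConv d t f y‖ₑ ≤ ∫⁻ z, ‖heatKernel d t (y - z)‖ₑ * ‖f z‖ₑ := by
    refine (enorm_integral_le_lintegral_enorm _).trans_eq ?_
    simp_rw [enorm_mul]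
  have h2 := ENNReal.lintegral_mul_norm_pow_le (μ := volume) (p := 1 / 2) (q := 1 / 2)
    hm.aemeasurable (hm.aemeasurable.mul (hf.enorm.pow_const 2)) (by norm_num) (by norm_num)
    (by norm_num)
  rw [lintegral_heatKernel_sub_left ht, ENNReal.one_rpow, one_mul] at h2
  have h3 : ∀ a b : ℝ≥0∞, a ^ (1 / 2 : ℝ) * (a * b ^ 2) ^ (1 / 2 : ℝ) = a * b := by
    intro a b
    rw [ENNReal.mul_rpow_of_nonneg _ _ (by norm_num), ← mul_assoc,
      ← ENNReal.rpow_add_of_nonneg _ _ (by norm_num) (by norm_num), ← ENNReal.rpow_natCast,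
      ← ENNReal.rpow_mul]
    norm_num
  simp only [Pi.mul_apply, h3] at h2
  calc ‖heatConv d t f y‖ₑ ^ 2
      ≤ ((∫⁻ z, ‖heatKernel d t (y - z)‖ₑ * ‖f z‖ₑ ^ 2) ^ (1 / 2 : ℝ)) ^ 2 := by
        gcongr
        exact h1.trans h2
    _ = _ := by
        rw [← ENNReal.rpow_natCast, ← ENNReal.rpow_mul]
        norm_num

lemma aestronglyMeasurable_heatConv {f : EuclideanSpace ℝ (Fin d) → ℝ}
    (hf : AEStronglyMeasurable f volume) : AEStronglyMeasurable (heatConv d t f) volume := by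
  have h : AEStronglyMeasurable
      (fun p : EuclideanSpace ℝ (Fin d) × EuclideanSpace ℝ (Fin d) =>
        heatKernel d t (p.1 - p.2) * f p.2) (volume.prod volume) :=
    ((continuous_heatKernel d t).comp (by fun_prop)).aestronglyMeasurable.mul hf.comp_snd
  exact h.integral_prod_right'

lemma eLpNorm_heatConv_le (ht : 0 < t) {f : EuclideanSpace ℝ (Fin d) → ℝ}
    (hf : AEStronglyMeasurable f volume) :
    eLpNorm (heatConv d t f) 2 volume ≤ eLpNorm f 2 volume := by
  have key : ∫⁻ y, ‖heatConv d t f y‖ₑ ^ 2 ≤ ∫⁻ z, ‖f z‖ₑ ^ 2 := by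
    refine (lintegral_mono (enorm_heatConv_sq_le ht hf)).trans_eq ?_
    rw [lintegral_lintegral_swap]
    · refine lintegral_congr fun z => ?_
      rw [lintegral_mul_const, lintegral_heatKernel_sub_right ht, one_mul]
      exact ((continuous_heatKernel d t).comp (by fun_prop)).measurable.enorm
    · exact ((continuous_heatKernel d t).comp
        (by fun_prop : Continuous fun p : EuclideanSpace ℝ (Fin d) × EuclideanSpace ℝ (Fin d) =>
          p.1 - p.2)).measurable.enorm.aemeasurable.mul (hf.comp_snd.enorm.pow_const 2)
  have h2 : ∀ h : EuclideanSpace ℝ (Fin d) → ℝ,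
      eLpNorm h 2 volume = (∫⁻ y, ‖h y‖ₑ ^ 2) ^ (1 / 2 : ℝ) := by
    intro h
    rw [eLpNorm_eq_lintegral_rpow_enorm_toReal (by norm_num) (by norm_num)]
    norm_num
  rw [h2, h2]
  gcongr

lemma memLp_heatConv (ht : 0 < t) {f : EuclideanSpace ℝ (Fin d) → ℝ} (hf : MemLp f 2 volume) :
    MemLp (heatConv d t f) 2 volume :=
  ⟨aestronglyMeasurable_heatConv hf.1, (eLpNorm_heatConv_le ht hf.1).trans_lt hf.2⟩

/-- For `t > 0`, the contraction `f ↦ ∫ g_d(t, · - z) f(z) dz` of `L²(ℝ^d)`. -/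
noncomputable def heatOperator (d : ℕ) (t : ℝ) (ht : 0 < t) : L2 d →L[ℝ] L2 d :=
  LinearMap.mkContinuous
    { toFun := fun f => (memLp_heatConv ht (Lp.memLp f)).toLp (heatConv d t f)
      map_add' := fun f g => by
        rw [← MemLp.toLp_add]
        refine MemLp.toLp_congr _ _ (Filter.Eventually.of_forall fun y => ?_)
        simp only [heatConv, Pi.add_apply]
        rw [← integral_add (integrable_heatKernel_mul ht (Lp.memLp f) y)
          (integrable_heatKernel_mul ht (Lp.memLp g) y)]
        refine integral_congr_ae ?_
        filter_upwards [Lp.coeFn_add f g] with z hz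
        rw [hz, Pi.add_apply, mul_add]
      map_smul' := fun c f => by
        rw [RingHom.id_apply, ← MemLp.toLp_const_smul]
        refine MemLp.toLp_congr _ _ (Filter.Eventually.of_forall fun y => ?_)
        simp only [heatConv, Pi.smul_apply, smul_eq_mul]
        rw [← integral_const_mul]
        refine integral_congr_ae ?_
        filter_upwards [Lp.coeFn_smul c f] with z hz
        rw [hz, Pi.smul_apply, smul_eq_mul, mul_left_comm] }
    1 (fun f => by
      rw [one_mul]
      change ‖(memLp_heatConv ht (Lp.memLp f)).toLp (heatConv d t f)‖ ≤ ‖f‖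
      rw [Lp.norm_toLp, Lp.norm_def]
      exact ENNReal.toReal_mono (Lp.eLpNorm_ne_top f)
        (eLpNorm_heatConv_le ht (Lp.aestronglyMeasurable f)))

/-- The transition semigroup `(T_t)_{t ≥ 0}` of standard Brownian motion on `L²(ℝ^d)`:
`T_0` is the identity and `T_t f = ∫ g_d(t, · - z) f(z) dz` for `t > 0`. (The value at `t < 0` is
a placeholder.) -/
noncomputable def brownianSemigroup (d : ℕ) (t : ℝ) : L2 d →L[ℝ] L2 d :=
  open Classical in
  if ht : 0 < t then heatOperator d t ht else ContinuousLinearMap.id ℝ (L2 d)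

end Semigroup

/-- The non-negative elements of the entrance space of the Brownian semigroup on `L²(ℝ^d)`:
those `x` for which every `x s` is almost everywhere non-negative. -/
def nonnegEntranceSpace (d : ℕ) : Set (PosTime → L2 d) :=
  {x | x ∈ entranceSpace (brownianSemigroup d) ∧
    ∀ s, 0 ≤ᵐ[volume] (x s : EuclideanSpace ℝ (Fin d) → ℝ)}

/-- The non-negative Borel measures `μ` on `ℝ^d`, finite or infinite, such that
`∫_0^l ds ∫ μ(dx) ∫ g_d(2 s, y - x) μ(dy) < ∞` for some `l > 0`. -/
def finiteEnergyMeasures (d : ℕ) : Set (Measure (EuclideanSpace ℝ (Fin d))) :=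
  {μ | ∃ l : ℝ, 0 < l ∧
    ∫⁻ s in Set.Ioc 0 l, ∫⁻ x, ∫⁻ y, ENNReal.ofReal (heatKernel d (2 * s) (y - x)) ∂μ ∂μ < ∞}

end BrownianEntrance

/-!
Write `h_s(y) = ∫ g_d(s, y - z) μ(dz)` for the heat potential of a measure `μ`, with values in
`[0, ∞]`. By the Chapman–Kolmogorov equation (`lintegral_heatKernel_mul_heatKernel`) the heat
potentials satisfy `h_{s+t} = g_d(t, ·) * h_s`, and the energy `∫∫ g_d(2s, y - x) μ(dx) μ(dy)` is
`∫ h_s²` (`lintegral_lintegral_heatKernel_eq`). So the heat potentials of a measure of finite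
energy form an entrance path (`exists_mem_nonnegEntranceSpace`), and for a path of heat potentials
the local square integrability is the finiteness of the energy (`locallySquareIntegrable_iff`).

A path determines the measure (`eq_of_heatPotential_ae_eq`): by the semigroup property it determines
`h_1(y)` at every point `y`, and since `g_d(1, y - z) = e^{-|y|²/2} e^{⟨y, z⟩} g_d(1, z)`, the
function `h_1` is, up to a Gaussian factor, the moment generating function of the finite measure
`g_d(1, z) μ(dz)`.

Conversely let `x` be a non-negative entrance path (`exists_heatPotential_ae_eq`). The heat
potential at time `t` of the measure `x_s(z) dz` is a version of `x_{s+t}`, and it depends on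
`s + t` only; hence it converges as `s → 0`, to a version `U t` of `x_t`. This bounds the measures
`x_s(z) dz` on compact sets, and along an ultrafilter they converge on continuous functions of
compact support to a positive functional, that is, to a measure `μ`. That `U t` is the heat
potential of `μ` (`exists_heatPotential_eq_of_tendsto`) is then a matter of tightness: the part of
`g_d(t, y - ·)` outside a large ball is at most `ε g_d(2t, y - ·)`, whose integrals against
`x_s(z) dz` stay bounded.
-/

namespace BrownianEntrance

open Filter Topology CompactlySupported ProbabilityTheory

/-! ### The heat kernel and heat potentials -/

variable {d : ℕ}

lemma heatKernel_pos {t : ℝ} (ht : 0 < t) (x : EuclideanSpace ℝ (Fin d)) :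
    0 < heatKernel d t x := by
  unfold heatKernel
  positivity

lemma heatKernel_sub_comm (t : ℝ) (x y : EuclideanSpace ℝ (Fin d)) :
    heatKernel d t (x - y) = heatKernel d t (y - x) := by
  simp only [heatKernel, norm_sub_rev x y]

@[fun_prop]
lemma measurable_heatKernel (d : ℕ) (t : ℝ) : Measurable (heatKernel d t) :=
  (continuous_heatKernel d t).measurable

lemma lintegral_ofReal_heatKernel_sub_right {t : ℝ} (ht : 0 < t) (z : EuclideanSpace ℝ (Fin d)) :
    ∫⁻ y, ENNReal.ofReal (heatKernel d t (y - z)) = 1 := by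
  rw [← lintegral_heatKernel_sub_right ht z]
  exact lintegral_congr fun y => (Real.enorm_of_nonneg (heatKernel_nonneg ht _)).symm

/-- Completing the square in the product of two Gaussian densities. -/
lemma heatKernel_mul_heatKernel {s t : ℝ} (hs : 0 < s) (ht : 0 < t)
    (x y z : EuclideanSpace ℝ (Fin d)) :
    heatKernel d s (x - z) * heatKernel d t (z - y) =
      heatKernel d (s + t) (x - y) *
        heatKernel d (s * t / (s + t)) (z - ((t / (s + t)) • x + (s / (s + t)) • y)) := by
  have hst : 0 < s + t := by positivity
  set a := x - z with ha
  set b := z - y with hb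
  have h1 : x - y = a + b := by rw [ha, hb]; abel
  have h2 : z - ((t / (s + t)) • x + (s / (s + t)) • y) = (s + t)⁻¹ • (s • b - t • a) := by
    have : z = (s + t)⁻¹ • (s • z + t • z) := by
      rw [← add_smul, smul_smul, inv_mul_cancel₀ hst.ne', one_smul]
    nth_rewrite 1 [this]
    rw [ha, hb]
    simp only [div_eq_inv_mul, mul_smul, ← smul_add, ← smul_sub]
    congr 1
    simp only [smul_sub]
    abel
  rw [h1, h2]
  unfold heatKernel
  rw [mul_mul_mul_comm (1 / (2 * Real.pi * s) ^ ((d : ℝ) / 2)),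
    mul_mul_mul_comm (1 / (2 * Real.pi * (s + t)) ^ ((d : ℝ) / 2)), ← Real.exp_add, ← Real.exp_add]
  congr 1
  · rw [one_div_mul_one_div, one_div_mul_one_div, ← Real.mul_rpow (by positivity) (by positivity),
      ← Real.mul_rpow (by positivity) (by positivity)]
    congr 2
    field_simp
  · congr 1
    have e1 := norm_add_sq_real a b
    have e2 := norm_sub_sq_real (s • b) (t • a)
    rw [norm_smul, norm_smul, real_inner_smul_left, real_inner_smul_right, real_inner_comm,
      mul_pow, mul_pow, Real.norm_of_nonneg hs.le, Real.norm_of_nonneg ht.le] at e2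
    rw [norm_smul, mul_pow, e1, e2, Real.norm_of_nonneg (by positivity)]
    field_simp
    ring

/-- The Chapman–Kolmogorov equation. -/
lemma lintegral_heatKernel_mul_heatKernel {s t : ℝ} (hs : 0 < s) (ht : 0 < t)
    (x y : EuclideanSpace ℝ (Fin d)) :
    ∫⁻ z, ENNReal.ofReal (heatKernel d s (x - z)) * ENNReal.ofReal (heatKernel d t (z - y)) =
      ENNReal.ofReal (heatKernel d (s + t) (x - y)) := by
  simp_rw [← ENNReal.ofReal_mul (heatKernel_nonneg hs _), heatKernel_mul_heatKernel hs ht,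
    ENNReal.ofReal_mul (heatKernel_nonneg (add_pos hs ht) _)]
  rw [lintegral_const_mul _ (by fun_prop), lintegral_ofReal_heatKernel_sub_right (by positivity),
    mul_one]

/-- The function `y ↦ ∫ g_d(t, y - z) μ(dz)`, with values in `[0, ∞]`. -/
noncomputable def heatPotential (t : ℝ) (μ : Measure (EuclideanSpace ℝ (Fin d)))
    (y : EuclideanSpace ℝ (Fin d)) : ℝ≥0∞ :=
  ∫⁻ z, ENNReal.ofReal (heatKernel d t (y - z)) ∂μ

lemma measurable_heatPotential (t : ℝ) (μ : Measure (EuclideanSpace ℝ (Fin d))) [SFinite μ] :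
    Measurable (heatPotential t μ) := by
  unfold heatPotential
  exact Measurable.lintegral_prod_right' (f := fun p : EuclideanSpace ℝ (Fin d) ×
    EuclideanSpace ℝ (Fin d) => ENNReal.ofReal (heatKernel d t (p.1 - p.2))) (by fun_prop)

lemma integrable_heatKernel_iff {t : ℝ} (ht : 0 < t) (μ : Measure (EuclideanSpace ℝ (Fin d)))
    (y : EuclideanSpace ℝ (Fin d)) :
    Integrable (fun z => heatKernel d t (y - z)) μ ↔ heatPotential t μ y < ∞ := by
  have hm : AEStronglyMeasurable (fun z => heatKernel d t (y - z)) μ :=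
    ((continuous_heatKernel d t).comp (by fun_prop)).aestronglyMeasurable
  rw [Integrable, and_iff_right hm,
    hasFiniteIntegral_iff_ofReal (Filter.Eventually.of_forall fun z => heatKernel_nonneg ht _)]
  rfl

lemma integral_heatKernel_eq_toReal {t : ℝ} (ht : 0 < t)
    (μ : Measure (EuclideanSpace ℝ (Fin d))) (y : EuclideanSpace ℝ (Fin d)) :
    ∫ z, heatKernel d t (y - z) ∂μ = (heatPotential t μ y).toReal :=
  integral_eq_lintegral_of_nonneg_ae
    (Filter.Eventually.of_forall fun z => heatKernel_nonneg ht _)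
    ((continuous_heatKernel d t).comp (by fun_prop)).aestronglyMeasurable

/-- The semigroup property of heat potentials. -/
lemma lintegral_heatKernel_mul_heatPotential {s t : ℝ} (hs : 0 < s) (ht : 0 < t)
    (μ : Measure (EuclideanSpace ℝ (Fin d))) [SFinite μ] (y : EuclideanSpace ℝ (Fin d)) :
    ∫⁻ w, ENNReal.ofReal (heatKernel d t (y - w)) * heatPotential s μ w =
      heatPotential (s + t) μ y := by
  unfold heatPotential
  have h (w : EuclideanSpace ℝ (Fin d)) :
      ENNReal.ofReal (heatKernel d t (y - w)) *
          ∫⁻ z, ENNReal.ofReal (heatKernel d s (w - z)) ∂μ =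
        ∫⁻ z, ENNReal.ofReal (heatKernel d t (y - w)) *
          ENNReal.ofReal (heatKernel d s (w - z)) ∂μ :=
    (lintegral_const_mul _ (by fun_prop)).symm
  simp_rw [h]
  rw [lintegral_lintegral_swap (by fun_prop)]
  simp_rw [lintegral_heatKernel_mul_heatKernel ht hs, add_comm t s]

/-- The energy of `μ` at time `2 s` is the squared `L²` norm of its heat potential at time `s`. -/
lemma lintegral_lintegral_heatKernel_eq {s : ℝ} (hs : 0 < s)
    (μ : Measure (EuclideanSpace ℝ (Fin d))) [SFinite μ] :
    ∫⁻ x, ∫⁻ y, ENNReal.ofReal (heatKernel d (2 * s) (y - x)) ∂μ ∂μ =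
      ∫⁻ w, heatPotential s μ w ^ 2 := by
  have hm := measurable_heatPotential s μ
  calc ∫⁻ x, ∫⁻ y, ENNReal.ofReal (heatKernel d (2 * s) (y - x)) ∂μ ∂μ
      = ∫⁻ x, ∫⁻ w, ENNReal.ofReal (heatKernel d s (w - x)) * heatPotential s μ w ∂volume ∂μ := by
        refine lintegral_congr fun x => ?_
        simp_rw [heatKernel_sub_comm s _ x]
        rw [lintegral_heatKernel_mul_heatPotential hs hs, ← two_mul]
        simp_rw [heatKernel_sub_comm (2 * s) _ x]
        rfl
    _ = ∫⁻ w, ∫⁻ x, ENNReal.ofReal (heatKernel d s (w - x)) * heatPotential s μ w ∂μ :=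
        lintegral_lintegral_swap (by fun_prop)
    _ = ∫⁻ w, heatPotential s μ w ^ 2 := by
        refine lintegral_congr fun w => ?_
        rw [lintegral_mul_const _ (by fun_prop), sq]
        rfl

lemma ofReal_heatConv {t : ℝ} (ht : 0 < t) {f : EuclideanSpace ℝ (Fin d) → ℝ}
    (hf : MemLp f 2 volume) (hf0 : 0 ≤ᵐ[volume] f) (y : EuclideanSpace ℝ (Fin d)) :
    ENNReal.ofReal (heatConv d t f y) =
      ∫⁻ z, ENNReal.ofReal (heatKernel d t (y - z)) * ENNReal.ofReal (f z) := by
  rw [heatConv, ofReal_integral_eq_lintegral_ofReal (integrable_heatKernel_mul ht hf y)]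
  · simp_rw [ENNReal.ofReal_mul (heatKernel_nonneg ht _)]
  · filter_upwards [hf0] with z hz using mul_nonneg (heatKernel_nonneg ht _) hz

lemma heatPotential_withDensity (t : ℝ) {f : EuclideanSpace ℝ (Fin d) → ℝ≥0∞}
    (hf : AEMeasurable f volume) (y : EuclideanSpace ℝ (Fin d)) :
    heatPotential t (volume.withDensity f) y =
      ∫⁻ z, ENNReal.ofReal (heatKernel d t (y - z)) * f z := by
  rw [heatPotential, lintegral_withDensity_eq_lintegral_mul₀ hf (by fun_prop)]
  simp_rw [Pi.mul_apply, mul_comm]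

/-! ### Limits of heat potentials -/

lemma exists_norm_le_mul_heatKernel (φ : C_c(EuclideanSpace ℝ (Fin d), ℝ)) {t : ℝ} (ht : 0 < t)
    (y : EuclideanSpace ℝ (Fin d)) : ∃ C : ℝ, ∀ z, ‖φ z‖ ≤ C * heatKernel d t (y - z) := by
  have hc : Continuous fun z => φ z / heatKernel d t (y - z) :=
    φ.continuous.div₀ ((continuous_heatKernel d t).comp (by fun_prop))
      fun z => (heatKernel_pos ht _).ne'
  have hs : HasCompactSupport fun z => φ z / heatKernel d t (y - z) := by
    simp_rw [div_eq_mul_inv]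
    exact φ.hasCompactSupport.mul_right
  obtain ⟨C, hC⟩ := hc.bounded_above_of_compact_support hs
  refine ⟨C, fun z => ?_⟩
  have h := hC z
  rwa [norm_div, Real.norm_of_nonneg (heatKernel_nonneg ht _),
    div_le_iff₀ (heatKernel_pos ht _)] at h

lemma integrable_of_heatPotential_ne_top {ν : Measure (EuclideanSpace ℝ (Fin d))} {t : ℝ}
    (ht : 0 < t) {y : EuclideanSpace ℝ (Fin d)} (hν : heatPotential t ν y ≠ ∞)
    (φ : C_c(EuclideanSpace ℝ (Fin d), ℝ)) : Integrable φ ν := by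
  obtain ⟨C, hC⟩ := exists_norm_le_mul_heatKernel φ ht y
  exact (((integrable_heatKernel_iff ht ν y).2 hν.lt_top).const_mul C).mono'
    φ.continuous.aestronglyMeasurable (Eventually.of_forall hC)

lemma heatKernel_eq_exp_mul_heatKernel {t : ℝ} (ht : 0 < t) (v : EuclideanSpace ℝ (Fin d)) :
    heatKernel d t v =
      2 ^ ((d : ℝ) / 2) * Real.exp (-‖v‖ ^ 2 / (4 * t)) * heatKernel d (2 * t) v := by
  unfold heatKernel
  have h : (2 * Real.pi * (2 * t)) ^ ((d : ℝ) / 2) =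
      2 ^ ((d : ℝ) / 2) * (2 * Real.pi * t) ^ ((d : ℝ) / 2) := by
    rw [← Real.mul_rpow (by positivity) (by positivity)]
    congr 1
    ring
  have h2 : Real.exp (-‖v‖ ^ 2 / (2 * t)) =
      Real.exp (-‖v‖ ^ 2 / (4 * t)) * Real.exp (-‖v‖ ^ 2 / (2 * (2 * t))) := by
    rw [← Real.exp_add]
    congr 1
    field_simp
    ring
  rw [h, h2]
  have h3 : (0 : ℝ) < (2 * Real.pi * t) ^ ((d : ℝ) / 2) := by positivity
  field_simp

lemma eventually_heatKernel_le {t ε : ℝ} (ht : 0 < t) (hε : 0 < ε) :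
    ∀ᶠ v in cocompact (EuclideanSpace ℝ (Fin d)),
      heatKernel d t v ≤ ε * heatKernel d (2 * t) v := by
  have h1 : Tendsto (fun v : EuclideanSpace ℝ (Fin d) => -‖v‖ ^ 2 / (4 * t))
      (cocompact _) atBot := by
    refine Tendsto.atBot_div_const (by positivity) (tendsto_neg_atTop_atBot.comp ?_)
    exact (tendsto_pow_atTop two_ne_zero).comp tendsto_norm_cocompact_atTop
  have h2 := (Real.tendsto_exp_atBot.comp h1).const_mul ((2 : ℝ) ^ ((d : ℝ) / 2))
  rw [mul_zero] at h2
  filter_upwards [h2.eventually_le_const hε] with v hv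
  rw [heatKernel_eq_exp_mul_heatKernel ht]
  exact mul_le_mul_of_nonneg_right hv (heatKernel_nonneg (by positivity) _)

/-- The compactly supported function `(g_d(t, y - ·) - ε g_d(2 t, y - ·))⁺`. It increases to
`g_d(t, y - ·)` as `ε` decreases to `0`, with an error that is at most `ε g_d(2 t, y - ·)`. -/
noncomputable def truncatedHeatKernel {t ε : ℝ} (ht : 0 < t) (hε : 0 < ε)
    (y : EuclideanSpace ℝ (Fin d)) : C_c(EuclideanSpace ℝ (Fin d), ℝ) where
  toFun z := max (heatKernel d t (y - z) - ε * heatKernel d (2 * t) (y - z)) 0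
  continuous_toFun := by
    have := continuous_heatKernel d t
    have := continuous_heatKernel d (2 * t)
    fun_prop
  hasCompactSupport' := by
    rw [hasCompactSupport_iff_eventuallyEq, coclosedCompact_eq_cocompact]
    have h := (Homeomorph.subLeft y).isClosedEmbedding.tendsto_cocompact.eventually
      (eventually_heatKernel_le (d := d) ht hε)
    filter_upwards [h] with z hz
    exact max_eq_right (sub_nonpos.2 hz)

/-- If the heat potentials of the measures `ν i` converge pointwise along `l` to a finite limit at
all positive times, then the limit is the heat potential of a measure: a vague limit point of the
measures `ν i`, obtained from the Riesz–Markov–Kakutani theorem. No mass is lost at infinity, since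
`g_d(t, y - ·)` is negligible with respect to `g_d(2 t, y - ·)` there. -/
theorem exists_heatPotential_eq_of_tendsto {ι : Type*} (l : Filter ι) [l.NeBot]
    (ν : ι → Measure (EuclideanSpace ℝ (Fin d))) (U : ℝ → EuclideanSpace ℝ (Fin d) → ℝ≥0∞)
    (hU : ∀ t, 0 < t → ∀ y, U t y ≠ ∞) (hν : ∀ i, ∀ t, 0 < t → ∀ y, heatPotential t (ν i) y ≠ ∞)
    (h : ∀ t, 0 < t → ∀ y, Tendsto (fun i => heatPotential t (ν i) y) l (𝓝 (U t y))) :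
    ∃ μ : Measure (EuclideanSpace ℝ (Fin d)), ∀ t, 0 < t → ∀ y, heatPotential t μ y = U t y := by
  have hreal (t : ℝ) (ht : 0 < t) (y : EuclideanSpace ℝ (Fin d)) :
      Tendsto (fun i => ∫ z, heatKernel d t (y - z) ∂ν i) l (𝓝 (U t y).toReal) := by
    simp_rw [integral_heatKernel_eq_toReal ht]
    exact (ENNReal.tendsto_toReal (hU t ht y)).comp (h t ht y)
  have hgi (i : ι) (t : ℝ) (ht : 0 < t) (y : EuclideanSpace ℝ (Fin d)) :
      Integrable (fun z => heatKernel d t (y - z)) (ν i) :=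
    (integrable_heatKernel_iff ht _ y).2 (hν i t ht y).lt_top
  have hφi (i : ι) (φ : C_c(EuclideanSpace ℝ (Fin d), ℝ)) : Integrable φ (ν i) :=
    integrable_of_heatPotential_ne_top one_pos (hν i 1 one_pos 0) φ
  set F : Ultrafilter ι := Ultrafilter.of l
  have hF : (F : Filter ι) ≤ l := Ultrafilter.of_le l
  have hlim (φ : C_c(EuclideanSpace ℝ (Fin d), ℝ)) :
      ∃ L : ℝ, Tendsto (fun i => ∫ z, φ z ∂ν i) F (𝓝 L) := by
    obtain ⟨C, hC⟩ := exists_norm_le_mul_heatKernel φ one_pos 0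
    have hb : ∀ᶠ i in l, ‖∫ z, φ z ∂ν i‖ ≤ C * (U 1 0).toReal + 1 := by
      filter_upwards [((hreal 1 one_pos 0).const_mul C).eventually_le_const
        (lt_add_one (C * (U 1 0).toReal))] with i hi
      refine le_trans ?_ hi
      rw [← integral_const_mul]
      exact norm_integral_le_of_norm_le ((hgi i 1 one_pos 0).const_mul C) (Eventually.of_forall hC)
    have hb' : (F.map fun i => ∫ z, φ z ∂ν i : Filter ℝ) ≤
        𝓟 (Metric.closedBall 0 (C * (U 1 0).toReal + 1)) := by
      rw [le_principal_iff, Ultrafilter.coe_map, mem_map]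
      filter_upwards [hb.filter_mono hF] with i hi
      exact mem_closedBall_zero_iff.2 hi
    obtain ⟨L, -, hL⟩ := (isCompact_closedBall (0 : ℝ) (C * (U 1 0).toReal + 1)).ultrafilter_le_nhds
      _ hb'
    exact ⟨L, hL⟩
  choose Λ₀ hΛ₀ using hlim
  let Λ : C_c(EuclideanSpace ℝ (Fin d), ℝ) →ₚ[ℝ] ℝ := PositiveLinearMap.mk₀
    { toFun := Λ₀
      map_add' := fun φ ψ => by
        refine tendsto_nhds_unique (hΛ₀ (φ + ψ)) (((hΛ₀ φ).add (hΛ₀ ψ)).congr fun i => ?_)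
        exact (integral_add (hφi i φ) (hφi i ψ)).symm
      map_smul' := fun c φ => by
        refine tendsto_nhds_unique (hΛ₀ (c • φ)) (((hΛ₀ φ).const_mul c).congr fun i => ?_)
        exact (integral_const_mul c _).symm }
    (fun φ hφ => ge_of_tendsto (hΛ₀ φ) (Eventually.of_forall fun i => integral_nonneg hφ))
  have hΛ (φ : C_c(EuclideanSpace ℝ (Fin d), ℝ)) :
      Tendsto (fun i => ∫ z, φ z ∂ν i) F (𝓝 (∫ z, φ z ∂(RealRMK.rieszMeasure Λ))) := by
    rw [RealRMK.integral_rieszMeasure]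
    exact hΛ₀ φ
  refine ⟨RealRMK.rieszMeasure Λ, fun t ht y => ?_⟩
  set μ := RealRMK.rieszMeasure Λ
  have ht2 : 0 < 2 * t := by positivity
  set φ : ℕ → C_c(EuclideanSpace ℝ (Fin d), ℝ) :=
    fun n => truncatedHeatKernel ht (Nat.one_div_pos_of_nat (α := ℝ) (n := n)) y
  have hφ (n : ℕ) (z : EuclideanSpace ℝ (Fin d)) : φ n z =
    max (heatKernel d t (y - z) - 1 / ((n : ℝ) + 1) * heatKernel d (2 * t) (y - z)) 0 := rfl
  have hup (n : ℕ) : ∫ z, φ n z ∂μ ≤ (U t y).toReal := by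
    refine le_of_tendsto_of_tendsto (hΛ (φ n)) ((hreal t ht y).mono_left hF)
      (Eventually.of_forall fun i => ?_)
    refine integral_mono (hφi i _) (hgi i t ht y) fun z => ?_
    have := heatKernel_nonneg ht2 (y - z)
    exact max_le (sub_le_self _ (by positivity)) (heatKernel_nonneg ht _)
  have hlow (n : ℕ) : (U t y).toReal - 1 / ((n : ℝ) + 1) * (U (2 * t) y).toReal ≤
      ∫ z, φ n z ∂μ := by
    refine le_of_tendsto_of_tendsto
      (((hreal t ht y).sub ((hreal _ ht2 y).const_mul (1 / ((n : ℝ) + 1)))).mono_left hF)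
      (hΛ (φ n)) (Eventually.of_forall fun i => ?_)
    dsimp only
    rw [← integral_const_mul, ← integral_sub (hgi i t ht y) ((hgi i _ ht2 y).const_mul _)]
    exact integral_mono ((hgi i t ht y).sub ((hgi i _ ht2 y).const_mul _)) (hφi i _)
      fun z => le_max_left _ _
  have hinv : Tendsto (fun n : ℕ => 1 / ((n : ℝ) + 1)) atTop (𝓝 0) :=
    tendsto_one_div_add_atTop_nhds_zero_nat
  have hlimφ : Tendsto (fun n => ∫ z, φ n z ∂μ) atTop (𝓝 (U t y).toReal) := by
    refine tendsto_of_tendsto_of_tendsto_of_le_of_le ?_ tendsto_const_nhds hlow hup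
    simpa using (hinv.mul_const (U (2 * t) y).toReal).const_sub (U t y).toReal
  have hmono : Tendsto (fun n => ∫⁻ z, ENNReal.ofReal (φ n z) ∂μ) atTop
      (𝓝 (heatPotential t μ y)) := by
    refine lintegral_tendsto_of_tendsto_of_monotone
      (fun n => (φ n).continuous.measurable.ennreal_ofReal.aemeasurable)
      (Eventually.of_forall fun z m n hmn => ?_) (Eventually.of_forall fun z => ?_)
    · refine ENNReal.ofReal_le_ofReal ?_
      rw [hφ, hφ]
      have := heatKernel_nonneg ht2 (y - z)
      gcongr
    · refine ENNReal.tendsto_ofReal ?_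
      have := ((hinv.mul_const (heatKernel d (2 * t) (y - z))).const_sub
        (heatKernel d t (y - z))).max (tendsto_const_nhds (x := (0 : ℝ)))
      simpa [hφ, max_eq_left (heatKernel_nonneg ht _)] using this
  have heq (n : ℕ) : ∫⁻ z, ENNReal.ofReal (φ n z) ∂μ = ENNReal.ofReal (∫ z, φ n z ∂μ) :=
    (ofReal_integral_eq_lintegral_ofReal
      ((φ n).continuous.integrable_of_hasCompactSupport (φ n).hasCompactSupport)
      (Eventually.of_forall fun z => le_max_right _ _)).symm
  simp_rw [heq] at hmono
  rw [tendsto_nhds_unique hmono (ENNReal.tendsto_ofReal hlimφ), ENNReal.ofReal_toReal (hU t ht y)]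

/-! ### Uniqueness of the measure -/

section MGF

variable {E : Type*} [NormedAddCommGroup E] [InnerProductSpace ℝ E] [CompleteSpace E]
  [SecondCountableTopology E] [MeasurableSpace E] [BorelSpace E]

/-- Two finite measures on a Hilbert space with the same, everywhere finite, moment generating
function are equal. -/
theorem ext_of_lintegral_exp_inner_eq {μ ν : Measure E} [IsFiniteMeasure μ] [IsFiniteMeasure ν]
    (hfin : ∀ y, ∫⁻ z, ENNReal.ofReal (Real.exp (inner ℝ y z)) ∂μ ≠ ∞)
    (h : ∀ y, ∫⁻ z, ENNReal.ofReal (Real.exp (inner ℝ y z)) ∂μ =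
      ∫⁻ z, ENNReal.ofReal (Real.exp (inner ℝ y z)) ∂ν) : μ = ν := by
  refine Measure.ext_of_charFun (funext fun y => ?_)
  have hlin (t : ℝ) : (fun z : E => ENNReal.ofReal (Real.exp (inner ℝ (t • y) z))) =
      fun z => ENNReal.ofReal (Real.exp (t * inner ℝ y z)) := by
    simp_rw [real_inner_smul_left]
  have hmgf (ρ : Measure E) (t : ℝ) : mgf (fun z : E => inner ℝ y z) ρ t =
      (∫⁻ z, ENNReal.ofReal (Real.exp (inner ℝ (t • y) z)) ∂ρ).toReal := by
    rw [hlin, mgf, integral_eq_lintegral_of_nonneg_ae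
      (Eventually.of_forall fun z => (Real.exp_pos _).le)]
    exact Continuous.aestronglyMeasurable (by fun_prop)
  have hXY : mgf (fun z : E => inner ℝ y z) μ = mgf (fun z : E => inner ℝ y z) ν :=
    funext fun t => by rw [hmgf, hmgf, h]
  have h0 : μ = 0 ↔ ν = 0 := by
    have := h 0
    simp only [inner_zero_left, Real.exp_zero, ENNReal.ofReal_one, lintegral_const, one_mul] at this
    rw [← Measure.measure_univ_eq_zero, this, Measure.measure_univ_eq_zero]
  have huniv : integrableExpSet (fun z : E => inner ℝ y z) μ = Set.univ := by
    refine Set.eq_univ_of_forall fun t => ?_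
    change Integrable (fun z : E => Real.exp (t * inner ℝ y z)) μ
    refine ⟨Continuous.aestronglyMeasurable (by fun_prop), ?_⟩
    rw [hasFiniteIntegral_iff_ofReal (Eventually.of_forall fun z => (Real.exp_pos _).le),
      ← hlin]
    exact (hfin _).lt_top
  -- The characteristic function at `y` is the complex moment generating function of `⟪y, ·⟫` at `i`.
  have key := eqOn_complexMGF_of_mgf' hXY h0 (x := Complex.I) (by simp [huniv])
  simpa only [complexMGF, charFun_apply, mul_comm Complex.I, real_inner_comm] using key

end MGF

lemma heatKernel_one_sub (y z : EuclideanSpace ℝ (Fin d)) :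
    heatKernel d 1 (y - z) =
      Real.exp (-‖y‖ ^ 2 / 2) * (heatKernel d 1 z * Real.exp (inner ℝ y z)) := by
  unfold heatKernel
  rw [mul_assoc (1 / _), ← Real.exp_add, mul_left_comm, ← Real.exp_add, norm_sub_sq_real]
  congr 2
  ring

/-- The heat potential at time `1` determines the measure: up to Gaussian factors it is the moment
generating function of the measure `g_d(1, z) μ(dz)`. -/
theorem eq_of_heatPotential_one_eq {μ ν : Measure (EuclideanSpace ℝ (Fin d))}
    (hμ : ∀ y, heatPotential 1 μ y ≠ ∞) (h : ∀ y, heatPotential 1 μ y = heatPotential 1 ν y) :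
    μ = ν := by
  set G : EuclideanSpace ℝ (Fin d) → ℝ≥0∞ := fun z => ENNReal.ofReal (heatKernel d 1 z)
  have hG : Measurable G := by fun_prop
  have hexp (ρ : Measure (EuclideanSpace ℝ (Fin d))) (y : EuclideanSpace ℝ (Fin d)) :
      heatPotential 1 ρ y = ENNReal.ofReal (Real.exp (-‖y‖ ^ 2 / 2)) *
        ∫⁻ z, ENNReal.ofReal (Real.exp (inner ℝ y z)) ∂ρ.withDensity G := by
    rw [lintegral_withDensity_eq_lintegral_mul _ hG (by fun_prop),
      ← lintegral_const_mul _ (by fun_prop)]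
    refine lintegral_congr fun z => ?_
    rw [heatKernel_one_sub, ENNReal.ofReal_mul (Real.exp_pos _).le,
      ENNReal.ofReal_mul (heatKernel_nonneg one_pos _)]
    rfl
  have hpos (y : EuclideanSpace ℝ (Fin d)) : ENNReal.ofReal (Real.exp (-‖y‖ ^ 2 / 2)) ≠ 0 := by
    simpa using Real.exp_pos _
  have hfin (y : EuclideanSpace ℝ (Fin d)) :
      ∫⁻ z, ENNReal.ofReal (Real.exp (inner ℝ y z)) ∂μ.withDensity G ≠ ∞ := by
    intro htop
    apply hμ y
    rw [hexp, htop, ENNReal.mul_top (hpos y)]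
  have heq (y : EuclideanSpace ℝ (Fin d)) :
      ∫⁻ z, ENNReal.ofReal (Real.exp (inner ℝ y z)) ∂μ.withDensity G =
        ∫⁻ z, ENNReal.ofReal (Real.exp (inner ℝ y z)) ∂ν.withDensity G := by
    have := h y
    rwa [hexp, hexp, ENNReal.mul_right_inj (hpos y) ENNReal.ofReal_ne_top] at this
  have : IsFiniteMeasure (μ.withDensity G) :=
    ⟨by simpa [lt_top_iff_ne_top] using hfin 0⟩
  have : IsFiniteMeasure (ν.withDensity G) :=
    ⟨by simpa [lt_top_iff_ne_top] using (heq 0).symm.trans_lt (hfin 0).lt_top⟩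
  have hden := ext_of_lintegral_exp_inner_eq hfin heq
  have hG0 (ρ : Measure (EuclideanSpace ℝ (Fin d))) : ∀ᵐ z ∂ρ, G z ≠ 0 :=
    Eventually.of_forall fun z => by simpa [G] using heatKernel_pos one_pos z
  have hGtop (ρ : Measure (EuclideanSpace ℝ (Fin d))) : ∀ᵐ z ∂ρ, G z ≠ ∞ :=
    Eventually.of_forall fun z => ENNReal.ofReal_ne_top
  rw [← withDensity_inv_same hG (hG0 μ) (hGtop μ), hden, withDensity_inv_same hG (hG0 ν) (hGtop ν)]

/-- The measure is the finite measure `g_d(t, y - z) μ(dz)` divided by its positive density. -/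
lemma sFinite_of_heatPotential_ne_top {μ : Measure (EuclideanSpace ℝ (Fin d))} {t : ℝ}
    (ht : 0 < t) {y : EuclideanSpace ℝ (Fin d)} (h : heatPotential t μ y ≠ ∞) : SFinite μ := by
  set G : EuclideanSpace ℝ (Fin d) → ℝ≥0∞ := fun z => ENNReal.ofReal (heatKernel d t (y - z))
  have hG : Measurable G := by fun_prop
  have : IsFiniteMeasure (μ.withDensity G) := isFiniteMeasure_withDensity h
  rw [← withDensity_inv_same hG (μ := μ)
    (Eventually.of_forall fun z => by simpa [G] using heatKernel_pos ht (y - z))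
    (Eventually.of_forall fun z => ENNReal.ofReal_ne_top)]
  infer_instance

lemma heatKernel_le_mul_heatKernel {t s : ℝ} (ht : 0 < t) (hts : t ≤ s) (hs : s ≤ 2 * t)
    (v : EuclideanSpace ℝ (Fin d)) :
    heatKernel d s v ≤ 2 ^ ((d : ℝ) / 2) * heatKernel d (2 * t) v := by
  have h : (2 * Real.pi * (2 * t)) ^ ((d : ℝ) / 2) =
      2 ^ ((d : ℝ) / 2) * (2 * Real.pi * t) ^ ((d : ℝ) / 2) := by
    rw [← Real.mul_rpow (by positivity) (by positivity)]
    congr 1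
    ring
  unfold heatKernel
  rw [h, ← mul_assoc, mul_one_div, mul_comm ((2 : ℝ) ^ _), div_mul_cancel_right₀ (by positivity),
    ← one_div]
  have hs0 : 0 < s := ht.trans_le hts
  have hexp : -‖v‖ ^ 2 / (2 * s) ≤ -‖v‖ ^ 2 / (2 * (2 * t)) := by
    rw [neg_div, neg_div]
    gcongr
  gcongr

lemma tendsto_heatPotential_nhdsGT {μ : Measure (EuclideanSpace ℝ (Fin d))} {t : ℝ} (ht : 0 < t)
    {y : EuclideanSpace ℝ (Fin d)} (h : heatPotential (2 * t) μ y ≠ ∞) :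
    Tendsto (fun s => heatPotential s μ y) (𝓝[>] t) (𝓝 (heatPotential t μ y)) := by
  refine tendsto_lintegral_filter_of_dominated_convergence
    (fun z => ENNReal.ofReal (2 ^ ((d : ℝ) / 2)) *
      ENNReal.ofReal (heatKernel d (2 * t) (y - z)))
    (Eventually.of_forall fun s => by fun_prop) ?_ ?_ (Eventually.of_forall fun z => ?_)
  · have hlt : t < 2 * t := by linarith
    filter_upwards [Ioc_mem_nhdsGT hlt] with s hs
    refine Eventually.of_forall fun z => ?_
    rw [← ENNReal.ofReal_mul (by positivity)]
    exact ENNReal.ofReal_le_ofReal (heatKernel_le_mul_heatKernel ht hs.1.le hs.2 _)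
  · rw [lintegral_const_mul _ (by fun_prop)]
    exact ENNReal.mul_ne_top ENNReal.ofReal_ne_top h
  · refine ENNReal.tendsto_ofReal (Tendsto.mono_left ?_ nhdsWithin_le_nhds)
    have h1 : (2 * Real.pi * t) ^ ((d : ℝ) / 2) ≠ 0 := by positivity
    have h2 : 2 * t ≠ 0 := by positivity
    have h3 : 2 * Real.pi * t ≠ 0 := by positivity
    change ContinuousAt (fun s => heatKernel d s (y - z)) t
    unfold heatKernel
    fun_prop (disch := first | assumption | (left; assumption))

/-! ### Entrance paths are heat potentials -/

section Entrance

lemma brownianSemigroup_apply_ae {t : ℝ} (ht : 0 < t) (f : L2 d) :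
    brownianSemigroup d t f =ᵐ[volume] heatConv d t f := by
  rw [brownianSemigroup, dif_pos ht]
  exact MemLp.coeFn_toLp (memLp_heatConv ht (Lp.memLp f))

/-- The measure with density `f⁺` with respect to Lebesgue measure. -/
noncomputable def densityMeasure (f : L2 d) : Measure (EuclideanSpace ℝ (Fin d)) :=
  volume.withDensity fun z => ENNReal.ofReal (f z)

instance (f : L2 d) : SFinite (densityMeasure f) := by
  unfold densityMeasure
  infer_instance

lemma heatPotential_densityMeasure (t : ℝ) (f : L2 d) (y : EuclideanSpace ℝ (Fin d)) :
    heatPotential t (densityMeasure f) y =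
      ∫⁻ z, ENNReal.ofReal (heatKernel d t (y - z)) * ENNReal.ofReal (f z) :=
  heatPotential_withDensity t (Lp.aestronglyMeasurable f).aemeasurable.ennreal_ofReal y

variable {x : PosTime → L2 d}

lemma heatPotential_densityMeasure_ne_top {t : ℝ} (ht : 0 < t) {f : L2 d}
    (hf : 0 ≤ᵐ[volume] f) (y : EuclideanSpace ℝ (Fin d)) :
    heatPotential t (densityMeasure f) y ≠ ∞ := by
  rw [heatPotential_densityMeasure, ← ofReal_heatConv ht (Lp.memLp f) hf]
  exact ENNReal.ofReal_ne_top

lemma heatPotential_densityMeasure_ae (hx : x ∈ nonnegEntranceSpace d) (r t : PosTime) :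
    ∀ᵐ y, heatPotential t (densityMeasure (x r)) y = ENNReal.ofReal (x (r + t) y) := by
  rw [hx.1.1 r t]
  filter_upwards [brownianSemigroup_apply_ae t.2 (x r)] with y hy
  rw [hy, heatPotential_densityMeasure, ofReal_heatConv t.2 (Lp.memLp _) (hx.2 r)]

/-- For an entrance path `x`, the heat potential of `x r` at time `t` depends on `r + t` only. -/
lemma heatPotential_densityMeasure_add (hx : x ∈ nonnegEntranceSpace d) (r q t : PosTime)
    (y : EuclideanSpace ℝ (Fin d)) :
    heatPotential (q + t) (densityMeasure (x r)) y =
      heatPotential t (densityMeasure (x (r + q))) y := by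
  rw [← lintegral_heatKernel_mul_heatPotential q.2 t.2, heatPotential_densityMeasure]
  refine lintegral_congr_ae ?_
  filter_upwards [heatPotential_densityMeasure_ae hx r q] with w hw
  rw [hw]

/-- A non-negative entrance path consists of heat potentials of a measure, which is a vague limit
point of the measures `x s dz` as `s → 0`. -/
theorem exists_heatPotential_ae_eq (hx : x ∈ nonnegEntranceSpace d) :
    ∃ μ : Measure (EuclideanSpace ℝ (Fin d)), SFinite μ ∧
      ∀ s : PosTime, ∀ᵐ y, heatPotential s μ y = ENNReal.ofReal (x s y) := by
  -- `U t` is the everywhere defined version of `x t`.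
  set U : ℝ → EuclideanSpace ℝ (Fin d) → ℝ≥0∞ := fun t y =>
    if ht : 0 < t then heatPotential (t / 2) (densityMeasure (x ⟨t / 2, half_pos ht⟩)) y else 0
    with hUdef
  have hU (t : ℝ) (ht : 0 < t) (y : EuclideanSpace ℝ (Fin d)) : U t y =
      heatPotential (t / 2) (densityMeasure (x ⟨t / 2, half_pos ht⟩)) y := by
    simp only [hUdef, dif_pos ht]
  have hUfin (t : ℝ) (ht : 0 < t) (y : EuclideanSpace ℝ (Fin d)) : U t y ≠ ∞ := by
    rw [hU t ht]
    exact heatPotential_densityMeasure_ne_top (half_pos ht) (hx.2 _) y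
  set r : ℕ → PosTime := fun n => ⟨1 / ((n : ℝ) + 1), Nat.one_div_pos_of_nat⟩ with hr
  have hr0 : Tendsto (fun n => (r n : ℝ)) atTop (𝓝 0) := tendsto_one_div_add_atTop_nhds_zero_nat
  obtain ⟨μ, hμ⟩ := exists_heatPotential_eq_of_tendsto atTop (fun n => densityMeasure (x (r n))) U
    hUfin (fun n t ht y => heatPotential_densityMeasure_ne_top ht (hx.2 _) y) (fun t ht y => by
      have ht2 : 0 < t / 2 := half_pos ht
      rw [hU t ht]
      have hlim : Tendsto (fun n => t / 2 + (r n : ℝ)) atTop (𝓝[>] (t / 2)) := by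
        refine tendsto_nhdsWithin_of_tendsto_nhds_of_eventually_within _ ?_
          (Eventually.of_forall fun n => lt_add_of_pos_right _ (r n).2)
        simpa using hr0.const_add (t / 2)
      refine ((tendsto_heatPotential_nhdsGT ht2
        (heatPotential_densityMeasure_ne_top (by positivity) (hx.2 _) y)).comp hlim).congr' ?_
      filter_upwards [hr0.eventually_lt_const ht2] with n hn
      have := heatPotential_densityMeasure_add hx (r n) ⟨t / 2 - r n, sub_pos.2 hn⟩
        ⟨t / 2 + r n, add_pos ht2 (r n).2⟩ y
      have e1 : t / 2 - (r n : ℝ) + (t / 2 + r n) = t := by ring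
      have e2 : r n + ⟨t / 2 - r n, sub_pos.2 hn⟩ = (⟨t / 2, ht2⟩ : PosTime) :=
        Subtype.ext (add_sub_cancel _ _)
      rw [e2] at this
      simp only [e1] at this
      exact this.symm)
  refine ⟨μ, sFinite_of_heatPotential_ne_top (y := 0) one_pos
    (by rw [hμ 1 one_pos]; exact hUfin 1 one_pos 0), fun s => ?_⟩
  have hs2 : (⟨s / 2, half_pos s.2⟩ + ⟨s / 2, half_pos s.2⟩ : PosTime) = s :=
    Subtype.ext (add_halves _)
  have := heatPotential_densityMeasure_ae hx ⟨s / 2, half_pos s.2⟩ ⟨s / 2, half_pos s.2⟩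
  rw [hs2] at this
  filter_upwards [this] with y hy
  rw [hμ s s.2, hU s s.2, hy]

end Entrance

/-! ### Measures of finite energy -/

section Energy

variable {μ : Measure (EuclideanSpace ℝ (Fin d))}

lemma exists_energy_ne_top (hμ : μ ∈ finiteEnergyMeasures d) {t : ℝ} (ht : 0 < t) :
    ∃ s, 0 < s ∧ s < t ∧
      ∫⁻ x, ∫⁻ y, ENNReal.ofReal (heatKernel d (2 * s) (y - x)) ∂μ ∂μ ≠ ∞ := by
  obtain ⟨l, hl, hfin⟩ := hμ
  by_contra! hcon
  refine hfin.ne (top_unique ?_)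
  have hpos : 0 < min l (t / 2) := lt_min hl (half_pos ht)
  calc ∞ = ∫⁻ s in Set.Ioc 0 (min l (t / 2)), ∞ := by
        rw [setLIntegral_const, Real.volume_Ioc, sub_zero,
          ENNReal.top_mul (ENNReal.ofReal_pos.2 hpos).ne']
    _ = ∫⁻ s in Set.Ioc 0 (min l (t / 2)),
          ∫⁻ x, ∫⁻ y, ENNReal.ofReal (heatKernel d (2 * s) (y - x)) ∂μ ∂μ := by
        refine setLIntegral_congr_fun measurableSet_Ioc fun s hs => ?_
        exact (hcon s hs.1 (by linarith [hs.2.trans (min_le_right _ _)])).symm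
    _ ≤ _ := lintegral_mono_set (Set.Ioc_subset_Ioc_right (min_le_left _ _))

/-- Measures of finite energy are s-finite, as Tonelli's theorem requires: unless `μ = 0`, the heat
potential is finite at some point. -/
lemma sFinite_of_mem_finiteEnergyMeasures (hμ : μ ∈ finiteEnergyMeasures d) : SFinite μ := by
  obtain ⟨s, hs, -, hfin⟩ := exists_energy_ne_top hμ one_pos
  by_cases h : ∃ y, heatPotential (2 * s) μ y ≠ ∞
  · obtain ⟨y, hy⟩ := h
    exact sFinite_of_heatPotential_ne_top (by positivity) hy
  · push Not at h
    have h0 : μ = 0 := by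
      simp_rw [heatKernel_sub_comm] at hfin
      change ∫⁻ x, heatPotential (2 * s) μ x ∂μ ≠ ∞ at hfin
      simp_rw [h] at hfin
      by_contra hne
      apply hfin
      rw [lintegral_const, ENNReal.top_mul]
      simpa using hne
    rw [h0]
    infer_instance

lemma ofReal_heatConv_toReal_heatPotential [SFinite μ] {s t : ℝ} (hs : 0 < s) (ht : 0 < t)
    (hL : MemLp (fun y => (heatPotential s μ y).toReal) 2 volume)
    (hfin : ∀ᵐ y, heatPotential s μ y ≠ ∞) (y : EuclideanSpace ℝ (Fin d)) :
    ENNReal.ofReal (heatConv d t (fun y => (heatPotential s μ y).toReal) y) =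
      heatPotential (s + t) μ y := by
  rw [ofReal_heatConv ht hL (Eventually.of_forall fun _ => ENNReal.toReal_nonneg),
    ← lintegral_heatKernel_mul_heatPotential hs ht]
  refine lintegral_congr_ae ?_
  filter_upwards [hfin] with w hw
  rw [ENNReal.ofReal_toReal hw]

lemma heatConv_nonneg {t : ℝ} (ht : 0 < t) {f : EuclideanSpace ℝ (Fin d) → ℝ}
    (hf : 0 ≤ᵐ[volume] f) (y : EuclideanSpace ℝ (Fin d)) : 0 ≤ heatConv d t f y := by
  refine integral_nonneg_of_ae ?_
  filter_upwards [hf] with z hz using mul_nonneg (heatKernel_nonneg ht _) hz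

/-- The heat potentials of a measure of finite energy are finite and square integrable at all
positive times: at small times by hypothesis, and later because the heat semigroup contracts `L²`
and maps it to finite functions. -/
lemma heatPotential_ne_top_and_memLp (hμ : μ ∈ finiteEnergyMeasures d) {t : ℝ} (ht : 0 < t) :
    (∀ y, heatPotential t μ y ≠ ∞) ∧ MemLp (fun y => (heatPotential t μ y).toReal) 2 volume := by
  have := sFinite_of_mem_finiteEnergyMeasures hμ
  obtain ⟨s, hs, hst, hfin⟩ := exists_energy_ne_top hμ ht
  rw [lintegral_lintegral_heatKernel_eq hs] at hfin
  have hm := measurable_heatPotential s μ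
  have hae : ∀ᵐ y, heatPotential s μ y ≠ ∞ := by
    filter_upwards [ae_lt_top (hm.pow_const 2) hfin] with y hy h
    simp [h] at hy
  have hL : MemLp (fun y => (heatPotential s μ y).toReal) 2 volume := by
    refine ⟨hm.ennreal_toReal.aestronglyMeasurable, ?_⟩
    rw [eLpNorm_lt_top_iff_lintegral_rpow_enorm_lt_top two_ne_zero ENNReal.ofNat_ne_top]
    refine lt_of_le_of_lt (lintegral_mono fun y => ?_) hfin.lt_top
    rw [ENNReal.toReal_ofNat, ENNReal.rpow_ofNat, Real.enorm_of_nonneg ENNReal.toReal_nonneg]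
    gcongr
    exact ENNReal.ofReal_toReal_le
  have hkey := ofReal_heatConv_toReal_heatPotential hs (sub_pos.2 hst) hL hae
  rw [add_sub_cancel] at hkey
  have h0 := heatConv_nonneg (sub_pos.2 hst) (f := fun y => (heatPotential s μ y).toReal)
    (Eventually.of_forall fun _ => ENNReal.toReal_nonneg)
  refine ⟨fun y => by rw [← hkey]; exact ENNReal.ofReal_ne_top, ?_⟩
  simp_rw [← hkey, ENNReal.toReal_ofReal (h0 _)]
  exact memLp_heatConv (sub_pos.2 hst) hL

end Energy

/-! ### The correspondence -/

section Correspondence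

variable {x : PosTime → L2 d} {μ ν : Measure (EuclideanSpace ℝ (Fin d))}

lemma ae_integrable_and_eq_integral_iff {s : ℝ} (hs : 0 < s) {f : EuclideanSpace ℝ (Fin d) → ℝ}
    (hf : 0 ≤ᵐ[volume] f) :
    (∀ᵐ y, Integrable (fun z => heatKernel d s (y - z)) μ ∧
        f y = ∫ z, heatKernel d s (y - z) ∂μ) ↔
      ∀ᵐ y, heatPotential s μ y = ENNReal.ofReal (f y) := by
  refine eventually_congr ?_
  filter_upwards [hf] with y hy
  rw [integrable_heatKernel_iff hs, integral_heatKernel_eq_toReal hs]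
  constructor
  · rintro ⟨h1, h2⟩
    rw [h2, ENNReal.ofReal_toReal h1.ne]
  · intro h
    rw [h]
    exact ⟨ENNReal.ofReal_lt_top, (ENNReal.toReal_ofReal hy).symm⟩

/-- The energy of the measure and the squared `L²` norm of the path agree up to any time. -/
lemma locallySquareIntegrable_iff [SFinite μ] (hx : ∀ s, 0 ≤ᵐ[volume] x s)
    (h : ∀ s : PosTime, ∀ᵐ y, heatPotential s μ y = ENNReal.ofReal (x s y)) :
    LocallySquareIntegrable x ↔ μ ∈ finiteEnergyMeasures d := by
  refine exists_congr fun l => and_congr_right fun hl => ?_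
  have hnorm (s : PosTime) : ‖x s‖ₑ ^ 2 =
      ∫⁻ x, ∫⁻ y, ENNReal.ofReal (heatKernel d (2 * s) (y - x)) ∂μ ∂μ := by
    rw [lintegral_lintegral_heatKernel_eq s.2, Lp.enorm_def]
    have := eLpNorm_nnreal_pow_eq_lintegral (f := x s) (μ := volume) (p := 2) two_ne_zero
    simp only [NNReal.coe_ofNat, ENNReal.rpow_ofNat, ENNReal.coe_ofNat] at this
    rw [this]
    refine lintegral_congr_ae ?_
    filter_upwards [h s, hx s] with y hy hy0
    rw [hy, Real.enorm_of_nonneg hy0]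
  have himage : Subtype.val '' {s : PosTime | (s : ℝ) ≤ l} = Set.Ioc 0 l := by
    ext s
    simp [and_comm]
  simp_rw [hnorm]
  rw [← himage]
  exact iff_of_eq (congrArg (· < ∞) (setLIntegral_subtype (μ := volume) (s := {s : ℝ | 0 < s})
    measurableSet_Ioi _ fun s =>
      ∫⁻ x, ∫⁻ y, ENNReal.ofReal (heatKernel d (2 * s) (y - x)) ∂μ ∂μ))

/-- The heat potentials of a measure of finite energy form a non-negative entrance path. -/
theorem exists_mem_nonnegEntranceSpace (hμ : μ ∈ finiteEnergyMeasures d) :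
    ∃ x ∈ nonnegEntranceSpace d,
      ∀ s : PosTime, ∀ᵐ y, heatPotential s μ y = ENNReal.ofReal (x s y) := by
  have := sFinite_of_mem_finiteEnergyMeasures hμ
  set x : PosTime → L2 d := fun s => (heatPotential_ne_top_and_memLp hμ s.2).2.toLp _
  have hx (s : PosTime) : x s =ᵐ[volume] fun y => (heatPotential s μ y).toReal :=
    MemLp.coeFn_toLp _
  have hx0 (s : PosTime) : 0 ≤ᵐ[volume] x s := by
    filter_upwards [hx s] with y hy
    rw [hy]
    exact ENNReal.toReal_nonneg
  have hrep (s : PosTime) : ∀ᵐ y, heatPotential s μ y = ENNReal.ofReal (x s y) := by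
    filter_upwards [hx s] with y hy
    rw [hy, ENNReal.ofReal_toReal ((heatPotential_ne_top_and_memLp hμ s.2).1 y)]
  refine ⟨x, ⟨⟨fun r t => Lp.ext ?_, (locallySquareIntegrable_iff hx0 hrep).2 hμ⟩, hx0⟩, hrep⟩
  filter_upwards [hx (r + t), brownianSemigroup_apply_ae t.2 (x r)] with y hy1 hy2
  obtain ⟨hfin, hL⟩ := heatPotential_ne_top_and_memLp hμ r.2
  have hconv : heatConv d t (x r) y = heatConv d t (fun y => (heatPotential r μ y).toReal) y := by
    refine integral_congr_ae ?_
    filter_upwards [hx r] with z hz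
    rw [hz]
  rw [hy1, hy2, hconv, show ((r + t : PosTime) : ℝ) = r + t from rfl,
    ← ofReal_heatConv_toReal_heatPotential r.2 t.2 hL
    (Eventually.of_forall hfin), ENNReal.toReal_ofReal (heatConv_nonneg t.2
      (Eventually.of_forall fun _ => ENNReal.toReal_nonneg) y)]

lemma eq_of_heatPotential_ae_eq (hμ : μ ∈ finiteEnergyMeasures d)
    (hν : ν ∈ finiteEnergyMeasures d)
    (h : ∀ s, 0 < s → heatPotential s μ =ᵐ[volume] heatPotential s ν) : μ = ν := by
  have := sFinite_of_mem_finiteEnergyMeasures hμ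
  have := sFinite_of_mem_finiteEnergyMeasures hν
  refine eq_of_heatPotential_one_eq (heatPotential_ne_top_and_memLp hμ one_pos).1 fun y => ?_
  -- The semigroup property turns the almost everywhere equality at time `1 / 2` into an equality
  -- at every point at time `1`.
  rw [← add_halves (1 : ℝ), ← lintegral_heatKernel_mul_heatPotential one_half_pos one_half_pos,
    ← lintegral_heatKernel_mul_heatPotential one_half_pos one_half_pos]
  refine lintegral_congr_ae ?_
  filter_upwards [h (1 / 2) one_half_pos] with w hw
  rw [hw]

end Correspondence

end BrownianEntrance

open BrownianEntrance in
theorem theorem5p1 (d : ℕ) :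
    ∃ e : BrownianEntrance.nonnegEntranceSpace d ≃ BrownianEntrance.finiteEnergyMeasures d,
      ∀ (x : BrownianEntrance.nonnegEntranceSpace d)
        (μ : BrownianEntrance.finiteEnergyMeasures d),
        e x = μ ↔
          ∀ s : BrownianEntrance.PosTime, ∀ᵐ y : EuclideanSpace ℝ (Fin d),
            Integrable (fun z => BrownianEntrance.heatKernel d s (y - z))
                (μ : Measure (EuclideanSpace ℝ (Fin d))) ∧
              (x : BrownianEntrance.PosTime → BrownianEntrance.L2 d) s y =
                ∫ z, BrownianEntrance.heatKernel d s (y - z)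
                  ∂(μ : Measure (EuclideanSpace ℝ (Fin d))) := by
  have hiff (x : nonnegEntranceSpace d) (μ : finiteEnergyMeasures d) (s : PosTime) :=
    ae_integrable_and_eq_integral_iff (μ := μ.1) s.2 (x.2.2 s)
  simp_rw [hiff]
  have hex (x : nonnegEntranceSpace d) : ∃ μ : finiteEnergyMeasures d, ∀ s : PosTime,
      ∀ᵐ y, heatPotential s μ.1 y = ENNReal.ofReal (x.1 s y) := by
    obtain ⟨μ, hμ, h⟩ := exists_heatPotential_ae_eq x.2
    exact ⟨⟨μ, (locallySquareIntegrable_iff x.2.2 h).1 x.2.1.2⟩, h⟩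
  have huniq (x : nonnegEntranceSpace d) (μ ν : finiteEnergyMeasures d)
      (hμ : ∀ s : PosTime, ∀ᵐ y, heatPotential s μ.1 y = ENNReal.ofReal (x.1 s y))
      (hν : ∀ s : PosTime, ∀ᵐ y, heatPotential s ν.1 y = ENNReal.ofReal (x.1 s y)) : μ = ν := by
    refine Subtype.ext (eq_of_heatPotential_ae_eq μ.2 ν.2 fun s hs => ?_)
    filter_upwards [hμ ⟨s, hs⟩, hν ⟨s, hs⟩] with y h1 h2
    exact h1.trans h2.symm
  choose e he using hex
  refine ⟨Equiv.ofBijective e ⟨fun x x' hxx' => ?_, fun μ => ?_⟩, fun x μ => ⟨?_, fun h => ?_⟩⟩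
  · refine Subtype.ext (funext fun s => Lp.ext ?_)
    have h' := he x' s
    rw [← hxx'] at h'
    filter_upwards [he x s, h', x.2.2 s, x'.2.2 s] with y h1 h2 h3 h4
    exact (ENNReal.ofReal_eq_ofReal_iff h3 h4).1 (h1.symm.trans h2)
  · obtain ⟨x, hx, h⟩ := exists_mem_nonnegEntranceSpace μ.2
    exact ⟨⟨x, hx⟩, huniq ⟨x, hx⟩ _ _ (he ⟨x, hx⟩) h⟩
  · rintro rfl
    exact he x
  · exact huniq x _ _ (he x) h
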